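/- **Theorem 4.4.** Let $n \geq 3$ be an integer and put $m = n+1$. Let $\mathbf G^{n}$ be the algebra on $\{0,1\}$ whose only operation is the $(n+2)$-ary term operation $$u(x_1,\dots,x_{n+2}) = (x_1 + x_2')\prod_{1\le i<j\le n+2,\; i,j\neq 2}(x_i+x_j)$$ of the two-element Boolean algebra ($+$ is join, juxtaposition and $\prod$ are meet, $'$ is complement). For $2\le j\le m$ let $\mathbf N^{j,m,+}$ be the algebra on $\{0,1\}$ whose only operation is the $(m+1)$-ary (that is, $(n+2)$-ary) term operation $$u^+_{j,m}(x_1,\dots,x_{m+1}) = \prod_{|J|=j}\ \sum_{i\in J} x_i$$ of the two-element lattice, where $J$ varies on the $j$-element subsets of $\{1,3,4,\dots,m+1\}$. Let $\ell = \frac{m+1}{2}$ if $m$ is odd and $\ell=\frac m2$ if $m$ is even, and let $\mathcal N_{n\frac12}$ be the variety generated by $\mathbf G^{n}$ and by all $\mathbf N^{j,m,+}$ with $3\le j\le \ell$ (so by $\mathbf G^{3}$ alone if $n=3$). Then: 1. $\mathcal N_{n\frac12}$ has an $n\frac12$-near-unanimity term, that is, an $(n+2)$-ary term $u$ for which the equations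 $u(z,z,x,\dots,x)=x$, $\;u(x,\dots,x,z,x,\dots,x)=x$ with $z$ in the $i$-th place for each $2\le i\le n+2$, and $u(x,x,x,z,\dots,z)=u(x,z,z,z,\dots,z)$ hold in $\mathcal N_{n\frac12}$. 2. $\mathcal N_{n\frac12}$ is not $(2n-4)$-distributive. Here a variety is $k$-distributive if it has ternary terms $t_0,\dots,t_k$ satisfying $t_0(x,y,z)=x$, $\;t_i(x,y,x)=x$ for $0\le i\le k$, $\;t_i(x,x,z)=t_{i+1}(x,x,z)$ for even $i$ with $0\le i<k$, $\;t_i(x,z,z)=t_{i+1}(x,z,z)$ for odd $i$ with $0\le i<k$, and $t_k(x,y,z)=z$. 3. More generally, the congruence identity $$\alpha(\beta\circ\gamma)\subseteq \alpha\beta\circ(\alpha(\gamma\circ\beta))^{n-3}\circ\alpha\gamma$$ fails in $\mathcal N_{n\frac12}$, that is, it fails for some congruences $\alpha,\beta,\gamma$ of some algebra in $\mathcal N_{n\frac12}$. Here juxtaposition of relations is intersection, $R^k$ is the composition of $k$ copies of $R$, and $R^0$ is the equality relation. -/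

import Mathlib

open scoped FirstOrder

namespace NearUnanimity

universe w

/-! ### Algebras, varieties, congruences -/

section General

variable (L : FirstOrder.Language.{0, 0})

/-- An algebra of the similarity type `L` (a language without relation symbols), bundled. -/
abbrev Alg := CategoryTheory.Bundled.{w} L.Structure

/-- The direct product of a family of algebras, with coordinatewise operations. -/
def piAlg {L : FirstOrder.Language.{0, 0}} {ι : Type w} (A : ι → Alg.{w} L) : Alg.{w} L where
  α := ∀ i, A i
  str :=
    { funMap := fun f x i => FirstOrder.Language.Structure.funMap f (fun k => x k i)
      RelMap := fun r x => ∀ i, FirstOrder.Language.Structure.RelMap r (fun k => x k i) }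

/-- A class of algebras is a variety if it is closed under homomorphic images, (nonempty)
subalgebras (taken up to isomorphism), and arbitrary direct products. -/
structure IsVariety [L.IsAlgebraic] (V : Set (Alg.{w} L)) : Prop where
  image_mem : ∀ A ∈ V, ∀ (B : Alg.{w} L) (f : A →[L] B), Function.Surjective f → B ∈ V
  sub_mem : ∀ A ∈ V, ∀ (B : Alg.{w} L) (_ : B ↪[L] A), Nonempty B → B ∈ V
  pi_mem : ∀ (ι : Type w) (A : ι → Alg.{w} L), (∀ i, A i ∈ V) → piAlg A ∈ V

/-- The variety generated by a class of algebras: the smallest variety containing it. -/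
def generatedVariety [L.IsAlgebraic] (K : Set (Alg.{w} L)) : Set (Alg.{w} L) :=
  {A | ∀ V : Set (Alg.{w} L), IsVariety L V → K ⊆ V → A ∈ V}

/-- A congruence of an algebra: an equivalence relation compatible with all operations. -/
structure Congruence (A : Type w) [L.Structure A] extends Setoid A where
  compat : ∀ {k : ℕ} (f : L.Functions k) (x y : Fin k → A), (∀ i, r (x i) (y i)) →
    r (FirstOrder.Language.Structure.funMap f x) (FirstOrder.Language.Structure.funMap f y)

end General

/-- `relPow R k = R ∘ R ∘ ⋯ ∘ R` with `k` factors; `relPow R 0` is the equality relation. -/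
def relPow {A : Type w} (R : A → A → Prop) : ℕ → A → A → Prop
  | 0 => Eq
  | k + 1 => Relation.Comp R (relPow R k)

/-! ### Term conditions and the congruence identity -/

section Conditions

variable {L : FirstOrder.Language.{0, 0}}

/-- The class `V` has an `n½`-near-unanimity term: a term `u` of arity `n + 2` such that
* `u(z, z, x, …, x) = x`,
* `u(x, …, x, z, x, …, x) = x` with `z` in any place other than the first one,
* `u(x, x, x, z, …, z) = u(x, z, z, z, …, z)`

hold in all algebras of `V`. -/
def HasHalfNearUnanimityTerm (V : Set (Alg.{w} L)) (n : ℕ) : Prop :=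
  ∃ u : L.Term (Fin (n + 2)), ∀ A ∈ V, ∀ x z : A,
    u.realize (fun i => if i.val < 2 then z else x) = x ∧
    (∀ i : Fin (n + 2), i ≠ 0 → u.realize (Function.update (fun _ => x) i z) = x) ∧
    u.realize (fun i => if i.val < 3 then x else z) =
      u.realize (fun i => if i.val < 1 then x else z)

/-- The class `V` is `k`-distributive: it has a sequence `t 0, …, t k` of Jónsson terms
(the values `t i` for `i > k` are irrelevant). -/
def IsDistributive (V : Set (Alg.{w} L)) (k : ℕ) : Prop :=
  ∃ t : ℕ → L.Term (Fin 3), ∀ A ∈ V, ∀ x y z : A,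
    (t 0).realize ![x, y, z] = x ∧
    (∀ i ≤ k, (t i).realize ![x, y, x] = x) ∧
    (∀ i < k, Even i → (t i).realize ![x, x, z] = (t (i + 1)).realize ![x, x, z]) ∧
    (∀ i < k, Odd i → (t i).realize ![x, z, z] = (t (i + 1)).realize ![x, z, z]) ∧
    (t k).realize ![x, y, z] = z

/-- The congruence identity `α(β ∘ γ) ⊆ αβ ∘ (α(γ ∘ β))^k ∘ αγ` holds in every algebra of `V`,
where juxtaposition is intersection. -/
def SatisfiesCongruenceIdentity (V : Set (Alg.{w} L)) (k : ℕ) : Prop :=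
  ∀ A ∈ V, ∀ α β γ : Congruence L A,
    α.r ⊓ Relation.Comp β.r γ.r ≤
      Relation.Comp (α.r ⊓ β.r)
        (Relation.Comp (relPow (α.r ⊓ Relation.Comp γ.r β.r) k) (α.r ⊓ γ.r))

end Conditions

/-! ### The variety `N_{n½}` -/

/-- The only operation symbol, of arity `n + 2`. -/
inductive OpSymbol (n : ℕ) : ℕ → Type
  | op : OpSymbol n (n + 2)

/-- The similarity type with a single operation symbol, of arity `n + 2`. -/
def opLanguage (n : ℕ) : FirstOrder.Language.{0, 0} where
  Functions := OpSymbol n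
  Relations := fun _ => Empty

instance (n : ℕ) : (opLanguage n).IsAlgebraic :=
  fun _ => inferInstanceAs (IsEmpty Empty)

/-- The algebra with base set `A` and the single `(n + 2)`-ary operation `f`. -/
def mkAlg {n : ℕ} {A : Type w} (f : (Fin (n + 2) → A) → A) : Alg.{w} (opLanguage n) where
  α := A
  str :=
    { funMap := fun {_} s => match s with
        | OpSymbol.op => f
      RelMap := fun r => nomatch r }

/-- The lattice polynomial `∏_{|J| = j} ∑_{i ∈ J} x_i` in `m + 1` variables, where `J` varies on
the `j`-element sets of places other than the second one (which has index `1` in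
`Fin (m + 1)`). -/
def latticeOp {B : Type w} [DistribLattice B] [BoundedOrder B] (j m : ℕ)
    (x : Fin (m + 1) → B) : B :=
  ((Finset.univ.erase (1 : Fin (m + 1))).powersetCard j).inf (fun J => J.sup x)

/-- The Boolean polynomial `(x_1 + x_2') ∏_{i < j; i, j ≠ 2} (x_i + x_j)` in `n + 2` variables
(the place `i` has index `i - 1` in `Fin (n + 2)`). -/
def booleanOp {B : Type w} [BooleanAlgebra B] (n : ℕ) (x : Fin (n + 2) → B) : B :=
  (x 0 ⊔ (x 1)ᶜ) ⊓
    (Finset.univ.filter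
      (fun p : Fin (n + 2) × Fin (n + 2) => p.1 < p.2 ∧ p.1 ≠ 1 ∧ p.2 ≠ 1)).inf
      (fun p => x p.1 ⊔ x p.2)

/-- The reduct of the two-element Boolean algebra with operation `booleanOp n`. -/
def algG (n : ℕ) : Alg.{0} (opLanguage n) :=
  mkAlg (booleanOp (B := Bool) n)

/-- The reduct of the two-element lattice with operation `latticeOp j m`, where `m = n + 1`. -/
def algN (n j : ℕ) : Alg.{0} (opLanguage n) :=
  mkAlg (latticeOp (B := Bool) j (n + 1))

/-- `ell m = (m + 1) / 2` if `m` is odd, `ell m = m / 2` if `m` is even. -/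
def ell (m : ℕ) : ℕ := if Odd m then (m + 1) / 2 else m / 2

/-- The variety `N_{n½}`, generated by `algG n` and by `algN n j` for `3 ≤ j ≤ ell (n + 1)`.
For `n = 3` there is no such `j`, and the only generator is `algG 3`. -/
def varietyN (n : ℕ) : Set (Alg.{0} (opLanguage n)) :=
  generatedVariety (opLanguage n)
    ({algG n} ∪ {A | ∃ j, 3 ≤ j ∧ j ≤ ell (n + 1) ∧ A = algN n j})

end NearUnanimity

/-! All operations involved are, wholly or in part, thresholds. Ignoring the second place,
`latticeOp j` is true iff fewer than `j` of the remaining `n + 1` places vanish, while truth of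
`booleanOp` forces fewer than two zeros. The near-unanimity identities are checked on the generators
by counting exceptional places, and they pass to the generated variety.

For the congruence identity, the counterexample is a subalgebra of a product of generators, cut out
by implications between components (`Admissible`). Conjunction adds numbers of zeros, so thresholds
`2` and `j` in the premises allow threshold `j + 1` in the conclusion (`Admissible.generatorOp`).
Each factor `α(γ ∘ β)` therefore costs one threshold unit. Information sent forward from one end and
backward from the other meets after `n - 3` factors, where `not_all` forbids it. Jónsson terms would
imply the identity, which settles distributivity. -/

namespace NearUnanimity

open FirstOrder FirstOrder.Language

/-! ### Identities, generated varieties and congruences. -/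

section Identities

variable {L : FirstOrder.Language.{0, 0}}

/-- The class of algebras satisfying a set of identities in the variables of `X`. -/
def identityClass (L : FirstOrder.Language.{0, 0}) {X : Type} (E : Set (L.Term X × L.Term X)) :
    Set (Alg.{w} L) :=
  {A | ∀ e ∈ E, ∀ v : X → A, e.1.realize v = e.2.realize v}

theorem realize_piAlg {X : Type} {ι : Type w} (A : ι → Alg.{w} L) (t : L.Term X)
    (v : X → piAlg A) (i : ι) :
    (t.realize v : piAlg A) i = t.realize (fun k => (v k : ∀ i, A i) i) := by
  induction t with
  | var => rfl
  | func f ts ih =>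
    change Structure.funMap f (fun k => ((ts k).realize v : piAlg A) i) = _
    simp only [ih, Term.realize_func]

theorem isVariety_identityClass [L.IsAlgebraic] {X : Type} (E : Set (L.Term X × L.Term X)) :
    IsVariety.{w} L (identityClass L E) where
  image_mem := by
    intro A hA B f hf e he v
    obtain ⟨g, hg⟩ : ∃ g : X → A, f ∘ g = v :=
      ⟨fun k => (hf (v k)).choose, funext fun k => (hf (v k)).choose_spec⟩
    rw [← hg, HomClass.realize_term, HomClass.realize_term, hA e he]
  sub_mem := by
    intro A hA B f _ e he v
    apply f.injective
    rw [← HomClass.realize_term, ← HomClass.realize_term, hA e he]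
  pi_mem := by
    intro ι A hA e he v
    funext i
    rw [realize_piAlg, realize_piAlg]
    exact hA i e he _

theorem isVariety_generatedVariety [L.IsAlgebraic] (K : Set (Alg.{w} L)) :
    IsVariety L (generatedVariety L K) where
  image_mem := fun A hA B f hf V hV hK => hV.image_mem A (hA V hV hK) B f hf
  sub_mem := fun A hA B f hB V hV hK => hV.sub_mem A (hA V hV hK) B f hB
  pi_mem := fun ι A hA V hV hK => hV.pi_mem ι A fun i => hA i V hV hK

theorem subset_generatedVariety [L.IsAlgebraic] (K : Set (Alg.{w} L)) :
    K ⊆ generatedVariety L K :=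
  fun _ hA _ _ hK => hK hA

theorem Congruence.realize {A : Type w} [L.Structure A] (θ : Congruence L A) {X : Type}
    (t : L.Term X) {v v' : X → A} (h : ∀ k, θ.r (v k) (v' k)) :
    θ.r (t.realize v) (t.realize v') := by
  induction t with
  | var k => exact h k
  | func f ts ih => exact θ.compat f _ _ ih

end Identities

/-! ### Powers of relations, and Jónsson terms. -/

section RelPow

variable {A : Type w} {R : A → A → Prop}

theorem exists_of_relPow_add {p q : ℕ} {a c : A} (h : relPow R (p + q) a c) :
    ∃ b, relPow R p a b ∧ relPow R q b c := by
  induction p generalizing a with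
  | zero => exact ⟨a, rfl, by simpa using h⟩
  | succ p ih =>
    rw [Nat.add_right_comm] at h
    obtain ⟨d, hd, h⟩ := h
    obtain ⟨b, hb, h⟩ := ih h
    exact ⟨b, ⟨d, hd, hb⟩, h⟩

theorem relPow_of_chain {p : ℕ} {s : ℕ → A} (h : ∀ i < p, R (s i) (s (i + 1))) :
    relPow R p (s 0) (s p) := by
  induction p generalizing s with
  | zero => rfl
  | succ p ih =>
    exact ⟨s 1, h 0 (by omega), ih (s := fun i => s (i + 1)) fun i hi => h (i + 1) (by omega)⟩

end RelPow

/-- Jónsson terms yield the corresponding congruence identity. -/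
theorem IsDistributive.satisfiesCongruenceIdentity {L : FirstOrder.Language.{0, 0}}
    {V : Set (Alg.{w} L)} {p : ℕ} (h : IsDistributive V (2 * p + 2)) :
    SatisfiesCongruenceIdentity V p := by
  obtain ⟨t, ht⟩ := h
  rintro A hA α β γ a c ⟨hac, b, hab, hbc⟩
  set s : ℕ → A := fun i => (t i).realize ![a, b, c] with hs
  have hα : ∀ i ≤ 2 * p + 2, α.r (s i) a := by
    intro i hi
    have h1 : α.r (s i) ((t i).realize ![a, b, a]) := by
      apply α.realize
      intro k
      fin_cases k
      · exact α.refl a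
      · exact α.refl b
      · exact α.symm hac
    rwa [(ht A hA a b c).2.1 i hi] at h1
  have hα' : ∀ i j, i ≤ 2 * p + 2 → j ≤ 2 * p + 2 → α.r (s i) (s j) := fun i j hi hj =>
    α.trans (hα i hi) (α.symm (hα j hj))
  have hβ : ∀ i, i < 2 * p + 2 → Even i → β.r (s i) (s (i + 1)) := by
    have key : ∀ i, β.r (s i) ((t i).realize ![a, a, c]) := by
      intro i
      apply β.realize
      intro k
      fin_cases k
      · exact β.refl a
      · exact β.symm hab
      · exact β.refl c
    intro i hi he
    have h1 := key i
    rw [(ht A hA a b c).2.2.1 i hi he] at h1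
    exact β.trans h1 (β.symm (key (i + 1)))
  have hγ : ∀ i, i < 2 * p + 2 → Odd i → γ.r (s i) (s (i + 1)) := by
    have key : ∀ i, γ.r (s i) ((t i).realize ![a, c, c]) := by
      intro i
      apply γ.realize
      intro k
      fin_cases k
      · exact γ.refl a
      · exact hbc
      · exact γ.refl c
    intro i hi he
    have h1 := key i
    rw [(ht A hA a b c).2.2.2.1 i hi he] at h1
    exact γ.trans h1 (γ.symm (key (i + 1)))
  have h0 : s 0 = a := (ht A hA a b c).1
  have hk : s (2 * p + 2) = c := (ht A hA a b c).2.2.2.2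
  rw [← h0, ← hk]
  refine ⟨s 1, ⟨hα' _ _ (by omega) (by omega), hβ 0 (by omega) (by simp)⟩, s (2 * p + 1),
    ?_, hα' _ _ (by omega) (by omega), hγ _ (by omega) ⟨p, rfl⟩⟩
  -- The first `β` link and the last `γ` link are split off; the inner links pair up as `γ` then `β`
  -- between odd indices.
  refine relPow_of_chain (s := fun i => s (2 * i + 1)) fun i hi =>
    ⟨hα' _ _ (by omega) (by omega), s (2 * i + 2), hγ _ (by omega) ⟨i, rfl⟩,
      hβ _ (by omega) ⟨i + 1, by ring⟩⟩

/-! ### The operations as threshold functions. -/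

section Counting

variable {n : ℕ}

/-- The places other than the second one at which a Boolean tuple vanishes. -/
def zeros (x : Fin (n + 2) → Bool) : Finset (Fin (n + 2)) :=
  (Finset.univ.erase 1).filter fun i => x i = false

theorem mem_zeros {x : Fin (n + 2) → Bool} {i : Fin (n + 2)} :
    i ∈ zeros x ↔ i ≠ 1 ∧ x i = false := by
  simp [zeros]

theorem card_univ_erase_one : (Finset.univ.erase (1 : Fin (n + 2))).card = n + 1 := by
  simp

theorem latticeOp_eq_true_iff (j : ℕ) (x : Fin (n + 2) → Bool) :
    latticeOp j (n + 1) x = true ↔ (zeros x).card < j := by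
  have h : latticeOp j (n + 1) x = true ↔
      ∀ J ∈ (Finset.univ.erase (1 : Fin (n + 2))).powersetCard j, ∃ i ∈ J, x i = true := by
    refine (Finset.inf_eq_top_iff _ _).trans (forall₂_congr fun J _ => ?_)
    have := Finset.sup_eq_bot_iff x J
    change J.sup x = true ↔ _
    rw [← Bool.not_eq_false, show (J.sup x = false) = (J.sup x = ⊥) from rfl, this]
    push Not
    simp
  rw [h]
  constructor
  · intro h
    by_contra hj
    obtain ⟨J, hJ, hc⟩ := Finset.exists_subset_card_eq (not_lt.1 hj)
    obtain ⟨i, hi, hx⟩ := h J (Finset.mem_powersetCard.2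
      ⟨hJ.trans (Finset.filter_subset _ _), hc⟩)
    simp [(mem_zeros.1 (hJ hi)).2] at hx
  · intro h J hJ
    rw [Finset.mem_powersetCard] at hJ
    by_contra hx
    push Not at hx
    have : J ⊆ zeros x := fun i hi =>
      Finset.mem_filter.2 ⟨hJ.1 hi, by simpa using hx i hi⟩
    have := Finset.card_le_card this
    omega

theorem booleanOp_eq_true_iff (x : Fin (n + 2) → Bool) :
    booleanOp n x = true ↔ (x 0 = true ∨ x 1 = false) ∧ (zeros x).card < 2 := by
  have h1 : booleanOp n x = true ↔ (x 0 ⊔ (x 1)ᶜ) = true ∧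
      ∀ p : Fin (n + 2) × Fin (n + 2), p.1 < p.2 ∧ p.1 ≠ 1 ∧ p.2 ≠ 1 →
        (x p.1 ⊔ x p.2) = true := by
    unfold booleanOp
    refine (inf_eq_top_iff (α := Bool)).trans (and_congr Iff.rfl ?_)
    rw [Finset.inf_eq_top_iff]
    simp only [Finset.mem_filter, Finset.mem_univ, true_and]
    rfl
  rw [h1]
  refine and_congr (by cases x 0 <;> cases x 1 <;> decide) ?_
  rw [Nat.lt_succ_iff, Finset.card_le_one]
  constructor
  · intro h a ha b hb
    rw [mem_zeros] at ha hb
    by_contra hab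
    rcases lt_or_gt_of_ne hab with hlt | hlt
    · simpa [ha.2, hb.2] using h (a, b) ⟨hlt, ha.1, hb.1⟩
    · simpa [ha.2, hb.2] using h (b, a) ⟨hlt, hb.1, ha.1⟩
  · rintro h ⟨a, b⟩ ⟨hlt, ha, hb⟩
    by_contra hx
    have hx' : x a = false ∧ x b = false := by
      revert hx
      cases x a <;> cases x b <;> simp
    exact hlt.ne (h a (mem_zeros.2 ⟨ha, hx'.1⟩) b (mem_zeros.2 ⟨hb, hx'.2⟩))

theorem card_zeros_le {x : Fin (n + 2) → Bool} (T : Finset (Fin (n + 2)))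
    (h : ∀ i, i ≠ 1 → i ∉ T → x i = true) : (zeros x).card ≤ T.card := by
  refine Finset.card_le_card fun i hi => ?_
  rw [mem_zeros] at hi
  by_contra hT
  simp [h i hi.1 hT] at hi

theorem le_card_zeros_add {x : Fin (n + 2) → Bool} (T : Finset (Fin (n + 2)))
    (h : ∀ i, i ≠ 1 → i ∉ T → x i = false) : n + 1 ≤ (zeros x).card + T.card := by
  have h1 : Finset.univ.erase (1 : Fin (n + 2)) ⊆ zeros x ∪ T := by
    intro i hi
    rw [Finset.mem_union, mem_zeros]
    by_cases hT : i ∈ T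
    · exact Or.inr hT
    · have hi' := Finset.ne_of_mem_erase hi
      exact Or.inl ⟨hi', h i hi' hT⟩
  rw [← card_univ_erase_one]
  exact (Finset.card_le_card h1).trans (Finset.card_union_le _ _)

/-- A threshold operation ignores exceptions at few places. -/
theorem latticeOp_eq_of_eq_off {j : ℕ} {x : Fin (n + 2) → Bool} {b : Bool}
    (T : Finset (Fin (n + 2))) (hT : T.card < j) (hT' : T.card + j ≤ n + 1)
    (h : ∀ i, i ≠ 1 → i ∉ T → x i = b) : latticeOp j (n + 1) x = b := by
  cases b
  · rw [← Bool.not_eq_true, latticeOp_eq_true_iff]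
    have := le_card_zeros_add T h
    omega
  · rw [latticeOp_eq_true_iff]
    have := card_zeros_le T h
    omega

/-- `booleanOp` ignores an exception at a single place, if the first factor is not smaller. -/
theorem booleanOp_eq_of_eq_off (hn : 2 ≤ n) {x : Fin (n + 2) → Bool} {b : Bool}
    (p : Fin (n + 2)) (h : ∀ i, i ≠ 1 → i ≠ p → x i = b)
    (hb : b = true → x 0 = true ∨ x 1 = false) : booleanOp n x = b := by
  have h' : ∀ i, i ≠ 1 → i ∉ ({p} : Finset _) → x i = b := fun i hi hp =>
    h i hi (by simpa using hp)
  cases b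
  · rw [← Bool.not_eq_true, booleanOp_eq_true_iff]
    have := le_card_zeros_add {p} h'
    rw [Finset.card_singleton] at this
    omega
  · rw [booleanOp_eq_true_iff]
    have := card_zeros_le {p} h'
    rw [Finset.card_singleton] at this
    exact ⟨hb rfl, by omega⟩

theorem two_le_val {i : Fin (n + 2)} (h0 : i ≠ 0) (h1 : i ≠ 1) : 2 ≤ i.val := by
  have h0 := Fin.val_ne_of_ne h0
  have h1 := Fin.val_ne_of_ne h1
  rw [Fin.val_zero] at h0
  rw [Fin.val_one] at h1
  omega

theorem three_le_val {i : Fin (n + 2)} (hn : 2 < n + 2) (h1 : i ≠ 1)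
    (h : i ∉ ({0, ⟨2, hn⟩} : Finset (Fin (n + 2)))) : 3 ≤ i.val := by
  rw [Finset.mem_insert, Finset.mem_singleton, not_or] at h
  have h2 : i.val ≠ 2 := Fin.val_ne_of_ne h.2
  have := two_le_val h.1 h1
  omega

/-- For `x` false and `z` true there is only one zero, so the value is decided by the factor `x_1 +
x_2'`. -/
theorem booleanOp_first_eq (hn : 3 ≤ n) (x z : Bool) :
    booleanOp n (fun i : Fin (n + 2) => if i.val < 1 then x else z) = (x && z) := by
  rcases Bool.eq_false_or_eq_true z with rfl | rfl
  · rcases Bool.eq_false_or_eq_true x with rfl | rfl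
    · exact booleanOp_eq_of_eq_off (by omega) 0 (by simp) (by simp)
    · rw [Bool.false_and, ← Bool.not_eq_true, booleanOp_eq_true_iff]
      simp
  · rw [Bool.and_false]
    refine booleanOp_eq_of_eq_off (by omega) 0 (fun i h1 h0 => if_neg ?_) (by simp)
    have := two_le_val h0 h1
    omega

/-- For `x` false and `z` true, the first and third places already give two zeros. -/
theorem booleanOp_first_three_eq (hn : 3 ≤ n) (x z : Bool) :
    booleanOp n (fun i : Fin (n + 2) => if i.val < 3 then x else z) = (x && z) := by
  rcases eq_or_ne x z with rfl | hxz
  · simp only [ite_self, Bool.and_self]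
    exact booleanOp_eq_of_eq_off (by omega) 0 (fun _ _ _ => rfl) (fun h => Or.inl h)
  have hxz' : (x && z) = false := by revert hxz; cases x <;> cases z <;> decide
  rw [hxz', ← Bool.not_eq_true, booleanOp_eq_true_iff]
  rintro ⟨-, hc⟩
  cases x
  · rw [Nat.lt_succ_iff, Finset.card_le_one] at hc
    have := hc 0 (mem_zeros.2 ⟨by simp, by simp⟩) ⟨2, by omega⟩
      (mem_zeros.2 ⟨by simp [Fin.ext_iff], by simp⟩)
    simp [Fin.ext_iff] at this
  · have hz : z = false := by simpa using hxz.symm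
    have := le_card_zeros_add (x := fun i : Fin (n + 2) => if i.val < 3 then true else z)
      {0, ⟨2, by omega⟩} (fun i hi hT => (if_neg (three_le_val _ hi hT).not_gt).trans hz)
    have := Finset.card_le_two (a := (0 : Fin (n + 2))) (b := ⟨2, by omega⟩)
    omega

end Counting

/-! ### The near-unanimity identities in the generators. -/

/-- Leaves room for two exceptional places when the other places are all false: `2 + j ≤ n + 1` for
every `j ≤ ell (n + 1)`. -/
theorem ell_le_sub_one {n : ℕ} (h : 3 ≤ ell (n + 1)) : ell (n + 1) ≤ n - 1 := by
  unfold ell at *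
  split_ifs at * <;> omega

/-- The basic operation symbol applied to the variables. -/
def opTerm (n : ℕ) : (opLanguage n).Term (Fin (n + 2)) :=
  Term.func (OpSymbol.op : (opLanguage n).Functions (n + 2)) Term.var

/-- The identities defining an `n½`-near-unanimity term, for the basic operation. -/
def halfNearUnanimityIdentities (n : ℕ) :
    Set ((opLanguage n).Term (Fin 2) × (opLanguage n).Term (Fin 2)) :=
  {((opTerm n).relabel (fun i => if i.val < 2 then 1 else 0), Term.var 0),
    ((opTerm n).relabel (fun i => if i.val < 3 then 0 else 1),
      (opTerm n).relabel (fun i => if i.val < 1 then 0 else 1))} ∪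
  {e | ∃ p : Fin (n + 2), p ≠ 0 ∧
    e = ((opTerm n).relabel (Function.update (fun _ => 0) p 1), Term.var 0)}

theorem mem_identityClass_halfNearUnanimityIdentities {n : ℕ} {A : Alg.{w} (opLanguage n)} :
    A ∈ identityClass (opLanguage n) (halfNearUnanimityIdentities n) ↔ ∀ x z : A,
      (opTerm n).realize (fun i => if i.val < 2 then z else x) = x ∧
      (∀ i : Fin (n + 2), i ≠ 0 →
        (opTerm n).realize (Function.update (fun _ => x) i z) = x) ∧
      (opTerm n).realize (fun i => if i.val < 3 then x else z) =
        (opTerm n).realize (fun i => if i.val < 1 then x else z) := by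
  have e1 (v : Fin 2 → A) (P : Fin (n + 2) → Prop) [DecidablePred P] (a b : Fin 2) :
      v ∘ (fun i => if P i then a else b) = fun i => if P i then v a else v b := by
    funext i
    exact apply_ite v _ _ _
  have e2 (v : Fin 2 → A) (p : Fin (n + 2)) :
      v ∘ Function.update (fun _ => 0) p 1 = Function.update (fun _ => v 0) p (v 1) := by
    rw [Function.comp_update]
    rfl
  constructor
  · intro h x z
    refine ⟨?_, fun p hp => ?_, ?_⟩
    · simpa [Term.realize_relabel, e1] using h _ (Or.inl (Or.inl rfl)) ![x, z]
    · simpa [Term.realize_relabel, e2] using h _ (Or.inr ⟨p, hp, rfl⟩) ![x, z]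
    · simpa [Term.realize_relabel, e1] using h _ (Or.inl (Or.inr rfl)) ![x, z]
  · rintro h _ ((rfl | rfl) | ⟨p, hp, rfl⟩) v
    · simpa only [Term.realize_var, Term.realize_relabel, e1] using (h (v 0) (v 1)).1
    · simpa only [Term.realize_var, Term.realize_relabel, e1] using (h (v 0) (v 1)).2.2
    · simpa only [Term.realize_var, Term.realize_relabel, e2] using (h (v 0) (v 1)).2.1 p hp

theorem algG_mem_identityClass {n : ℕ} (hn : 3 ≤ n) :
    algG n ∈ identityClass (opLanguage n) (halfNearUnanimityIdentities n) := by
  rw [mem_identityClass_halfNearUnanimityIdentities]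
  intro (x : Bool) (z : Bool)
  refine ⟨?_, fun p hp => ?_, ?_⟩
  · change booleanOp n (fun i : Fin (n + 2) => if i.val < 2 then z else x) = x
    refine booleanOp_eq_of_eq_off (by omega) 0 (fun i h1 h0 => if_neg ?_) fun _ => ?_
    · have := two_le_val h0 h1
      omega
    · cases z <;> simp
  · change booleanOp n (Function.update (fun _ => x) p z) = x
    refine booleanOp_eq_of_eq_off (by omega) p (fun i _ h => Function.update_of_ne h _ _)
      fun h => Or.inl ?_
    rw [Function.update_of_ne hp.symm, h]
  · exact (booleanOp_first_three_eq hn x z).trans (booleanOp_first_eq hn x z).symm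

theorem algN_mem_identityClass {n j : ℕ} (hj : 3 ≤ j) (hj' : j ≤ n - 1) :
    algN n j ∈ identityClass (opLanguage n) (halfNearUnanimityIdentities n) := by
  rw [mem_identityClass_halfNearUnanimityIdentities]
  intro (x : Bool) (z : Bool)
  refine ⟨?_, fun p hp => ?_, ?_⟩
  · change latticeOp j (n + 1) (fun i : Fin (n + 2) => if i.val < 2 then z else x) = x
    refine latticeOp_eq_of_eq_off {0} (by simp; omega) (by simp; omega)
      fun i h1 h0 => if_neg ?_
    have := two_le_val (by simpa using h0) h1
    omega
  · change latticeOp j (n + 1) (Function.update (fun _ => x) p z) = x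
    exact latticeOp_eq_of_eq_off {p} (by simp; omega) (by simp; omega)
      fun i _ h => Function.update_of_ne (by simpa using h) _ _
  · change latticeOp j (n + 1) (fun i : Fin (n + 2) => if i.val < 3 then x else z) =
      latticeOp j (n + 1) (fun i : Fin (n + 2) => if i.val < 1 then x else z)
    have hc := Finset.card_le_two (a := (0 : Fin (n + 2))) (b := ⟨2, by omega⟩)
    -- Unlike in `algG n`, both sides equal `z`: at most two relevant places differ from it, and `3
    -- ≤ j`.
    trans z
    · refine latticeOp_eq_of_eq_off {0, ⟨2, by omega⟩} (by omega) (by omega)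
        fun i h1 h0 => if_neg (three_le_val _ h1 h0).not_gt
    · refine (latticeOp_eq_of_eq_off {0} (by simp; omega) (by simp; omega)
        fun i h1 h0 => if_neg ?_).symm
      have := two_le_val (by simpa using h0) h1
      omega

theorem hasHalfNearUnanimityTerm_varietyN {n : ℕ} (hn : 3 ≤ n) :
    HasHalfNearUnanimityTerm (varietyN n) n := by
  refine ⟨opTerm n, fun A hA => mem_identityClass_halfNearUnanimityIdentities.1
    (hA _ (isVariety_identityClass _) ?_)⟩
  rintro _ (rfl | ⟨j, hj, hj', rfl⟩)
  · exact algG_mem_identityClass hn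
  · exact algN_mem_identityClass hj (hj'.trans (ell_le_sub_one (hj.trans hj')))

/-! ### Failure of the congruence identity -/

/-- The operation of `algN n j` for `3 ≤ j ≤ ell (n + 1)`, and that of `algG n` otherwise. -/
def generatorOp (n j : ℕ) : (Fin (n + 2) → Bool) → Bool :=
  if 3 ≤ j ∧ j ≤ ell (n + 1) then latticeOp j (n + 1) else booleanOp n

theorem mkAlg_generatorOp_mem (n j : ℕ) : mkAlg (generatorOp n j) ∈ varietyN n := by
  apply subset_generatedVariety
  unfold generatorOp
  split_ifs with h
  · exact Or.inr ⟨j, h.1, h.2, rfl⟩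
  · exact Or.inl rfl

theorem card_zeros_lt_of_generatorOp {n j : ℕ} (hj : 2 ≤ j) {x : Fin (n + 2) → Bool}
    (h : generatorOp n j x = true) : (zeros x).card < j := by
  unfold generatorOp at h
  split_ifs at h
  · exact (latticeOp_eq_true_iff j x).1 h
  · exact ((booleanOp_eq_true_iff x).1 h).2.trans_le hj

theorem generatorOp_eq_true {n j : ℕ} (hj : 3 ≤ j) (hj' : j ≤ ell (n + 1))
    {x : Fin (n + 2) → Bool} (h : (zeros x).card < j) : generatorOp n j x = true := by
  rw [generatorOp, if_pos ⟨hj, hj'⟩, latticeOp_eq_true_iff]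
  exact h

/-- The values of a triple of generators of the counterexample. -/
inductive Pattern
  | xxz | xyx | yzz | xzz | xyz

open Pattern

/-- The relations defining the base set of the counterexample. Here `f P j` is the component of
`f` in the `j`-th generating algebra, at the place where the three generators `x`, `y`, `z` of the
counterexample have the values `110`, `101`, `011`, `100`, `001`, respectively for the five
patterns `P` in the order of their definition. -/
structure Admissible (n : ℕ) (f : Pattern × ℕ → Bool) : Prop where
  xzz_of_xxz : ∀ j, 2 ≤ j → j + 1 ≤ ell (n + 1) → f (xyx, 2) = true → f (xxz, j) = true →
    f (xzz, j + 1) = true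
  xyz_of_yzz : ∀ j, 2 ≤ j → j + 1 ≤ ell (n + 1) → f (xyx, 2) = true → f (yzz, j) = true →
    f (xyz, j + 1) = true
  xxz_of_xzz : ∀ j, 3 ≤ j → j ≤ ell (n + 1) → f (xzz, j) = true → f (xxz, j) = true
  yzz_of_xyz : ∀ j, 3 ≤ j → j ≤ ell (n + 1) → f (xyz, j) = true → f (yzz, j) = true
  not_all : f (xyx, 2) = true → f (xxz, ell (n + 1)) = true →
    f (yzz, n + 1 - ell (n + 1)) = true → False


theorem card_zeros_le_of_and {n : ℕ} {x y z : Fin (n + 2) → Bool}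
    (h : ∀ k, y k = true → x k = true → z k = true) :
    (zeros z).card ≤ (zeros x).card + (zeros y).card := by
  refine (Finset.card_le_card fun k hk => ?_).trans (Finset.card_union_le _ _)
  rw [Finset.mem_union, mem_zeros, mem_zeros]
  rw [mem_zeros] at hk
  have h1 := h k
  cases hx : x k <;> cases hy : y k <;> simp_all

theorem zeros_subset {n : ℕ} {x y : Fin (n + 2) → Bool} (h : ∀ k, x k = true → y k = true) :
    zeros y ⊆ zeros x := by
  intro k hk
  rw [mem_zeros] at hk ⊢
  have h1 := h k
  cases hx : x k <;> simp_all

/-- Every conclusion other than `False` sits at an index between `3` and `ell (n + 1)`, where the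
operation is an exact threshold; in the premises only the upper bound on zeros is used, so
`booleanOp` may occur there. -/
theorem Admissible.generatorOp {n : ℕ} (hn : 3 ≤ n) {g : Fin (n + 2) → Pattern × ℕ → Bool}
    (hg : ∀ k, Admissible n (g k)) :
    Admissible n fun i => generatorOp n i.2 fun k => g k i where
  xzz_of_xxz := by
    intro j hj hj' h1 h2
    refine generatorOp_eq_true (by simpa using hj) hj' ?_
    have h1 := card_zeros_lt_of_generatorOp le_rfl h1
    have h2 := card_zeros_lt_of_generatorOp hj h2
    have := card_zeros_le_of_and fun k => (hg k).xzz_of_xxz j hj hj'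
    dsimp only at *
    omega
  xyz_of_yzz := by
    intro j hj hj' h1 h2
    refine generatorOp_eq_true (by simpa using hj) hj' ?_
    have h1 := card_zeros_lt_of_generatorOp le_rfl h1
    have h2 := card_zeros_lt_of_generatorOp hj h2
    have := card_zeros_le_of_and fun k => (hg k).xyz_of_yzz j hj hj'
    dsimp only at *
    omega
  xxz_of_xzz := by
    intro j hj hj' h
    refine generatorOp_eq_true hj hj' (lt_of_le_of_lt (Finset.card_le_card
      (zeros_subset fun k => (hg k).xxz_of_xzz j hj hj'))
      (card_zeros_lt_of_generatorOp (by omega) h))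
  yzz_of_xyz := by
    intro j hj hj' h
    refine generatorOp_eq_true hj hj' (lt_of_le_of_lt (Finset.card_le_card
      (zeros_subset fun k => (hg k).yzz_of_xyz j hj hj'))
      (card_zeros_lt_of_generatorOp (by omega) h))
  not_all := by
    intro h1 h2 h3
    have hl : 2 ≤ ell (n + 1) ∧ 2 ≤ n + 1 - ell (n + 1) := by
      unfold ell
      split_ifs with h
      · obtain ⟨k, hk⟩ := h
        omega
      · omega
    have h1 := card_zeros_lt_of_generatorOp le_rfl h1
    have h2 := card_zeros_lt_of_generatorOp hl.1 h2
    have h3 := card_zeros_lt_of_generatorOp hl.2 h3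
    -- The premises allow at most `1`, `ell (n + 1) - 1` and `n - ell (n + 1)` zeros, hence `n` in
    -- all. By `not_all` for each `g k`, these zeros would have to cover `n + 1` places.
    have hle := card_zeros_le_of_and (x := fun k => g k (xxz, ell (n + 1)))
      (y := fun k => g k (xyx, 2)) (z := fun k => !g k (yzz, n + 1 - ell (n + 1)))
      fun k hy hx => by simpa using fun hz => (hg k).not_all hy hx hz
    have hcov : Finset.univ.erase (1 : Fin (n + 2)) ⊆
        zeros (fun k => g k (yzz, n + 1 - ell (n + 1))) ∪
          zeros (fun k => !g k (yzz, n + 1 - ell (n + 1))) := by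
      intro k hk
      rw [Finset.mem_union, mem_zeros, mem_zeros]
      have := Finset.ne_of_mem_erase hk
      cases g k (yzz, n + 1 - ell (n + 1)) <;> simp [this]
    have := (Finset.card_le_card hcov).trans (Finset.card_union_le _ _)
    rw [card_univ_erase_one] at this
    omega

/-- The algebra of admissible families, in which the congruence identity fails. -/
def admissibleAlg {n : ℕ} (hn : 3 ≤ n) : Alg.{0} (opLanguage n) :=
  mkAlg (A := {f : Pattern × ℕ → Bool // Admissible n f}) fun g =>
    ⟨fun i => generatorOp n i.2 fun k => (g k).1 i, Admissible.generatorOp hn fun k => (g k).2⟩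

/-- Serves the families that do not depend on the index `j`, such as the three generators. -/
theorem admissible_of_eq {n : ℕ} (p : Pattern → Bool) (h1 : p xyx = true → p xxz = p xzz)
    (h2 : p xyx = true → p yzz = p xyz) (h3 : p xzz = true → p xxz = true)
    (h4 : p xyz = true → p yzz = true)
    (h5 : p xyx = true → p xxz = true → p yzz = true → False) :
    Admissible n fun i => p i.1 where
  xzz_of_xxz := fun _ _ _ h h' => (h1 h).symm.trans h'
  xyz_of_yzz := fun _ _ _ h h' => (h2 h).symm.trans h'
  xxz_of_xzz := fun _ _ _ => h3
  yzz_of_xyz := fun _ _ _ => h4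
  not_all := h5

theorem admissibleAlg_mem {n : ℕ} (hn : 3 ≤ n) : admissibleAlg hn ∈ varietyN n := by
  have hV := isVariety_generatedVariety (L := opLanguage n)
    ({algG n} ∪ {A | ∃ j, 3 ≤ j ∧ j ≤ ell (n + 1) ∧ A = algN n j})
  refine hV.sub_mem _ (hV.pi_mem (Pattern × ℕ) (fun i => mkAlg (generatorOp n i.2))
    fun i => mkAlg_generatorOp_mem n i.2) (admissibleAlg hn) ?_ ?_
  · exact
      { toFun := fun f => f.1
        inj' := Subtype.val_injective
        map_fun' := by
          rintro _ ⟨⟩ x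
          rfl
        map_rel' := fun r => nomatch r }
  · exact ⟨⟨fun _ => false, admissible_of_eq (fun _ => false) (by simp) (by simp) (by simp)
      (by simp) (by simp)⟩⟩

/-- The congruence of `admissibleAlg` given by equality of the components in `S`. -/
def componentCongruence {n : ℕ} (hn : 3 ≤ n) (S : Set (Pattern × ℕ)) :
    Congruence (opLanguage n) (admissibleAlg hn) where
  r := fun f g => ∀ i ∈ S, f.1 i = g.1 i
  iseqv :=
    { refl := fun _ _ _ => rfl
      symm := fun h i hi => (h i hi).symm
      trans := fun h h' i hi => (h i hi).trans (h' i hi) }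
  compat := by
    rintro _ ⟨⟩ x y h i hi
    exact congrArg (generatorOp n i.2) (funext fun k => h k i hi)

theorem not_satisfiesCongruenceIdentity_varietyN {n : ℕ} (hn : 3 ≤ n) :
    ¬ SatisfiesCongruenceIdentity (varietyN n) (n - 3) := by
  intro h
  have hl : 2 ≤ ell (n + 1) ∧ ell (n + 1) + 2 ≤ n + 1 := by
    unfold ell
    split_ifs with h
    · obtain ⟨k, hk⟩ := h
      omega
    · omega
  -- Each congruence keeps the patterns at which two of the generators agree: first and third for
  -- `α`, first and second for `β`, second and third for `γ`.
  let α := componentCongruence hn {i | i.1 = xyx}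
  let β := componentCongruence hn {i | i.1 = xxz ∨ i.1 = xyz}
  let γ := componentCongruence hn {i | i.1 = yzz ∨ i.1 = xzz}
  let pat : Pattern → Bool × Bool × Bool := fun P =>
    match P with
    | xxz => (true, true, false)
    | xyx => (true, false, true)
    | yzz => (false, true, true)
    | xzz => (true, false, false)
    | xyz => (false, false, true)
  let a : admissibleAlg hn := ⟨fun i => (pat i.1).1, admissible_of_eq (fun P => (pat P).1)
    (by decide) (by decide) (by decide) (by decide) (by decide)⟩
  let b : admissibleAlg hn := ⟨fun i => (pat i.1).2.1, admissible_of_eq (fun P => (pat P).2.1)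
    (by decide) (by decide) (by decide) (by decide) (by decide)⟩
  let c : admissibleAlg hn := ⟨fun i => (pat i.1).2.2, admissible_of_eq (fun P => (pat P).2.2)
    (by decide) (by decide) (by decide) (by decide) (by decide)⟩
  have hac : α.r a c := by
    rintro ⟨_, j⟩ rfl
    rfl
  have hab : β.r a b := by
    rintro ⟨_, j⟩ (rfl | rfl) <;> rfl
  have hbc : γ.r b c := by
    rintro ⟨_, j⟩ (rfl | rfl) <;> rfl
  obtain ⟨w, ⟨haw, haw'⟩, w', hww', ⟨hwc, hwc'⟩⟩ := h _ (admissibleAlg_mem hn) α β γ a c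
    ⟨hac, b, hab, hbc⟩
  have hw : w.1 (xyx, 2) = true := (haw (xyx, 2) rfl).symm
  have hwx : ∀ j, w.1 (xxz, j) = true := fun j => (haw' (xxz, j) (Or.inl rfl)).symm
  have hwz : ∀ j, w'.1 (yzz, j) = true := fun j => hwc' (yzz, j) (Or.inl rfl)
  -- Truth at `xxz` moves to `xzz` one index higher, crosses `γ` there, returns to `xxz` and crosses
  -- `β`.
  have forward : ∀ k (u u' : admissibleAlg hn), relPow (α.r ⊓ Relation.Comp γ.r β.r) k u u' →
      u.1 (xyx, 2) = true → ∀ i, 2 ≤ i →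
      (∀ j, i ≤ j → j ≤ ell (n + 1) → u.1 (xxz, j) = true) →
      u'.1 (xyx, 2) = true ∧ ∀ j, i + k ≤ j → j ≤ ell (n + 1) → u'.1 (xxz, j) = true := by
    intro k
    induction k with
    | zero =>
      rintro u _ rfl hu i _ hx
      exact ⟨hu, hx⟩
    | succ k ih =>
      rintro u u' ⟨v, ⟨huv, t, hut, htv⟩, hvu⟩ hu i hi hx
      have hv : v.1 (xyx, 2) = true := (huv (xyx, 2) rfl).symm.trans hu
      have := ih v u' hvu hv (i + 1) (by omega) fun j hj hj' => by
        obtain ⟨j, rfl⟩ : ∃ j', j = j' + 1 := ⟨j - 1, by omega⟩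
        have h1 := u.2.xzz_of_xxz j (by omega) hj' hu (hx j (by omega) (by omega))
        have h2 := (hut (xzz, j + 1) (Or.inr rfl)).symm.trans h1
        have h3 := t.2.xxz_of_xzz (j + 1) (by omega) hj' h2
        exact (htv (xxz, j + 1) (Or.inl rfl)).symm.trans h3
      exact ⟨this.1, fun j hj => this.2 j (by omega)⟩
  -- The mirror image: truth at `yzz` moves to `xyz`, crosses `β` backward, returns to `yzz` and
  -- crosses `γ`.
  have backward : ∀ k (u u' : admissibleAlg hn), relPow (α.r ⊓ Relation.Comp γ.r β.r) k u u' →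
      u.1 (xyx, 2) = true → (∀ j, u'.1 (yzz, j) = true) →
      ∀ j, k + 2 ≤ j → j ≤ ell (n + 1) → u.1 (yzz, j) = true := by
    intro k
    induction k with
    | zero =>
      rintro u _ rfl _ hz j _ _
      exact hz j
    | succ k ih =>
      rintro u u' ⟨v, ⟨huv, t, hut, htv⟩, hvu⟩ hu hz j hj hj'
      have hv : v.1 (xyx, 2) = true := (huv (xyx, 2) rfl).symm.trans hu
      obtain ⟨j, rfl⟩ : ∃ j', j = j' + 1 := ⟨j - 1, by omega⟩
      have h1 := v.2.xyz_of_yzz j (by omega) hj' hv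
        (ih v u' hvu hv hz j (by omega) (by omega))
      have h2 := (htv (xyz, j + 1) (Or.inr rfl)).trans h1
      have h3 := t.2.yzz_of_xyz (j + 1) (by omega) hj' h2
      exact (hut (yzz, j + 1) (Or.inl rfl)).trans h3
  have hle : n + 1 - ell (n + 1) ≤ ell (n + 1) := by
    unfold ell
    split_ifs with h
    · omega
    · rw [Nat.not_odd_iff] at h
      omega
  -- Starting from index `2`, these numbers of factors reach exactly the indices `ell (n + 1)` and
  -- `n + 1 - ell (n + 1)` of `not_all`.
  rw [show n - 3 = (ell (n + 1) - 2) + (n - 1 - ell (n + 1)) by omega] at hww'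
  obtain ⟨u, hwu, huw⟩ := exists_of_relPow_add hww'
  obtain ⟨hu, hux⟩ := forward _ _ _ hwu hw 2 le_rfl fun j _ _ => hwx j
  exact u.2.not_all hu (hux _ (by omega) le_rfl)
    (backward _ _ _ huw hu hwz _ (by omega) hle)

end NearUnanimity

theorem theorem4p4 (n : ℕ) (hn : 3 ≤ n) :
    NearUnanimity.HasHalfNearUnanimityTerm (NearUnanimity.varietyN n) n ∧
    ¬ NearUnanimity.IsDistributive (NearUnanimity.varietyN n) (2 * n - 4) ∧
    ¬ NearUnanimity.SatisfiesCongruenceIdentity (NearUnanimity.varietyN n) (n - 3) := by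
  have h := NearUnanimity.not_satisfiesCongruenceIdentity_varietyN hn
  refine ⟨NearUnanimity.hasHalfNearUnanimityTerm_varietyN hn, fun hd => h ?_, h⟩
  rw [show 2 * n - 4 = 2 * (n - 3) + 2 by omega] at hd
  exact hd.satisfiesCongruenceIdentity
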